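/- Let $\mathcal I\subset\mathbb R^n$ be a smooth embedded submanifold of dimension $m$ with the Riemannian metric inherited from the Euclidean inner product, and let $\mathrm T_x\mathcal I$ and $\mathrm N_x\mathcal I=(\mathrm T_x\mathcal I)^\perp$ be its tangent and normal spaces. The critical point problem is the computational problem with inputs $a\in\mathbb R^n$, outputs $x\in\mathcal I$ and solution manifold $$\mathcal S_{\mathrm{CPP}}=\{(a,x)\in\mathbb R^n\times\mathcal I \mid a-x\in \mathrm N_x\mathcal I\}.$$ Let $\Pi_{\mathbb R^n}:\mathcal S_{\mathrm{CPP}}\to\mathbb R^n$ and $\Pi_{\mathcal I}:\mathcal S_{\mathrm{CPP}}\to\mathcal I$ be the coordinate projections, and let $\mathcal W_{\mathrm{CPP}}$ be the set of well-posed tuples, i.e. of those $(a,x)\in\mathcal S_{\mathrm{CPP}}$ for which the derivative $\mathrm d_{(a,x)}\Pi_{\mathbb R^n}$ is invertible. If $(a,x)\in\mathcal W_{\mathrm{CPP}}$, then $\Pi_{\mathbb R^n}$ has a smooth inverse near $(a,x)$, and the condition number $\kappa[\mathcal S_{\mathrm{CPP}}](a,x)$ is the condition number of the local solution map $f=\Pi_{\mathcal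 I}\circ\Pi_{\mathbb R^n}^{-1}$ at $a$, $$\kappa[f](a)=\lim_{\varepsilon\to0}\ \sup_{0<\|a-a'\|\le\varepsilon}\frac{\mathrm{dist}_{\mathcal I}(f(a),f(a'))}{\|a-a'\|},$$ where $\mathrm{dist}_{\mathcal I}$ is the Riemannian distance of $\mathcal I$; for the other $(a,x)\in\mathcal S_{\mathrm{CPP}}$ one sets $\kappa[\mathcal S_{\mathrm{CPP}}](a,x)=\infty$. For $\eta\in\mathrm N_x\mathcal I$ let $S_\eta:\mathrm T_x\mathcal I\to\mathrm T_x\mathcal I$ be the Weingarten map: $S_\eta v$ is the orthogonal projection to $\mathrm T_x\mathcal I$ of $-\mathrm D_vN$, where $N$ is any smooth normal vector field on $\mathcal I$ near $x$ with $N(x)=\eta$. Theorem (critical points). Let $(a,x)\in\mathcal S_{\mathrm{CPP}}$, $\eta=a-x$, and let $H_\eta$ be the Riemannian Hessian at $x$ of the function $y\mapsto\frac12\|y-a\|^2$ on $\mathcal I$. Then: (1) $H_\eta=\mathbf 1-S_\eta$. (2) $\kappa[\mathcal S_{\mathrm{CPP}}](a,x)=\|H_\eta^{-1}\|$, the spectral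 norm on $\mathrm T_x\mathcal I$, which is read as $\infty$ if $H_\eta$ is not invertible. (3) For every unit vector $w\in\mathrm N_x\mathcal I$ with $\eta=\|\eta\|w$ (so $w=\eta/\|\eta\|$ if $\eta\ne0$) there is an orthonormal basis $u_1,\dots,u_m$ of $\mathrm T_x\mathcal I$ with $S_w u_i=c_iu_i$, where the $c_i\in\mathbb R$ are the principal curvatures of $\mathcal I$ at $x$ in direction $w$, and $$\kappa[\mathcal S_{\mathrm{CPP}}](a,x)=\max_{1\le i\le m}\frac1{\bigl|1-c_i\|\eta\|\bigr|},$$ with $1/0=\infty$ (and with the maximum read as $0$ if $m=0$). (4) If $(a,x)\notin\mathcal W_{\mathrm{CPP}}$, then $H_\eta$ is not invertible. -/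

import Mathlib

open Set Filter Topology
open scoped ENNReal ContDiff

/-- `M` is an embedded smooth submanifold of `E` of dimension `m`: around each point of `M` there
is a slice chart, i.e. a diffeomorphism `Φ` between open subsets of `E` that carries `M` onto a
linear subspace of dimension `m`. -/
def IsEmbeddedSubmanifold {E : Type*} [NormedAddCommGroup E] [NormedSpace ℝ E]
    (m : ℕ) (M : Set E) : Prop :=
  ∀ x ∈ M, ∃ (Φ : OpenPartialHomeomorph E E) (V : Submodule ℝ E),
    x ∈ Φ.source ∧ ContDiffOn ℝ ∞ Φ Φ.source ∧ ContDiffOn ℝ ∞ Φ.symm Φ.target ∧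
    Module.finrank ℝ V = m ∧ ∀ y ∈ Φ.source, y ∈ M ↔ Φ y ∈ V

/-- The tangent space at `p` of a submanifold `M` of a normed space, as a linear subspace of the
ambient space: the span of the velocities at time `0` of the smooth curves in `M` that pass
through `p` at time `0`. -/
def tangentSpaceOf {E : Type*} [NormedAddCommGroup E] [NormedSpace ℝ E]
    (M : Set E) (p : E) : Submodule ℝ E :=
  Submodule.span ℝ {v | ∃ (γ : ℝ → E) (ε : ℝ), 0 < ε ∧ ContDiffOn ℝ ∞ γ (Ioo (-ε) ε) ∧
    (∀ t ∈ Ioo (-ε) ε, γ t ∈ M) ∧ γ 0 = p ∧ HasDerivAt γ v 0}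

/-- The Riemannian distance on a submanifold `M` with the metric inherited from the ambient space:
the infimum of the lengths of the `C¹` curves in `M` from `p` to `q` (`∞` if there is none). -/
noncomputable def riemannianDistOn {E : Type*} [NormedAddCommGroup E] [NormedSpace ℝ E]
    (M : Set E) (p q : E) : ℝ≥0∞ :=
  ⨅ (γ : ℝ → E) (_ : ContDiffOn ℝ 1 γ (Icc 0 1) ∧ (∀ t ∈ Icc (0 : ℝ) 1, γ t ∈ M) ∧
      γ 0 = p ∧ γ 1 = q),
    ∫⁻ t in Icc (0 : ℝ) 1, ‖derivWithin γ (Icc 0 1) t‖ₑ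

section Condition

variable {E F : Type*} [NormedAddCommGroup E] [NormedSpace ℝ E]
  [NormedAddCommGroup F] [NormedSpace ℝ F]

/-- Rice's condition number at `a` of a map `f` (defined near `a`) from the Euclidean space `E` to
the Riemannian submanifold `Y` of `F`:
`lim_{ε → 0} sup_{0 < dist(a, a') ≤ ε} dist_Y(f a, f a') / dist(a, a')`. -/
noncomputable def riceConditionNumber (Y : Set F) (f : E → F) (a : E) : ℝ≥0∞ :=
  limsup (fun a' => riemannianDistOn Y (f a) (f a') / edist a a') (𝓝[≠] a)

/-- The derivative at `p` of the projection of the solution manifold `S ⊆ E × F` to the input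
space `E`. -/
noncomputable def inputProjDeriv (S : Set (E × F)) (p : E × F) : tangentSpaceOf S p →ₗ[ℝ] E :=
  (LinearMap.fst ℝ E F).comp (tangentSpaceOf S p).subtype

/-- `f` is a smooth solution map of `S` near `p`: the projection of `S` to the input space
restricts to a bijection from a neighbourhood of `p` in `S` onto a neighbourhood of `p.1`, with
smooth inverse `a ↦ (a, f a)`. -/
def IsLocalSolutionMap (S : Set (E × F)) (p : E × F) (f : E → F) : Prop :=
  ∃ (U : Set E) (W : Set (E × F)), IsOpen U ∧ IsOpen W ∧ p.1 ∈ U ∧ p ∈ W ∧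
    ContDiffOn ℝ ∞ f U ∧ S ∩ W = (fun a => (a, f a)) '' U

open Classical in
/-- The condition number at `p ∈ S` of the computational problem with input space `E`, output
manifold `Y ⊆ F` and solution manifold `S ⊆ E × Y`: Rice's condition number of the local solution
map if the derivative at `p` of the projection to the inputs is invertible, and `∞` otherwise.
The infimum only serves to pick the value: any two local solution maps agree near `p.1`, hence
have the same condition number, see `IsLocalSolutionMap.riceConditionNumber_eq`. -/
noncomputable def conditionNumber (S : Set (E × F)) (Y : Set F) (p : E × F) : ℝ≥0∞ :=
  if Function.Bijective (inputProjDeriv S p) then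
    ⨅ (f : E → F) (_ : IsLocalSolutionMap S p f), riceConditionNumber Y f p.1
  else ⊤

theorem IsLocalSolutionMap.apply_eq {S : Set (E × F)} {p : E × F} {f : E → F}
    (hp : p ∈ S) (hf : IsLocalSolutionMap S p f) : f p.1 = p.2 := by
  obtain ⟨U, W, -, -, -, hpW, -, h⟩ := hf
  have : p ∈ (fun a => (a, f a)) '' U := h ▸ ⟨hp, hpW⟩
  obtain ⟨a, -, rfl⟩ := this
  rfl

theorem IsLocalSolutionMap.eventuallyEq {S : Set (E × F)} {p : E × F} {f g : E → F}
    (hp : p ∈ S) (hf : IsLocalSolutionMap S p f) (hg : IsLocalSolutionMap S p g) :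
    f =ᶠ[𝓝 p.1] g := by
  have hfp := hf.apply_eq hp
  obtain ⟨U, W, hU, -, hpU, -, hfs, h⟩ := hf
  obtain ⟨U', W', -, hW', -, hpW', -, h'⟩ := hg
  have hc : ContinuousAt (fun a => (a, f a)) p.1 :=
    continuousAt_id.prodMk (hfs.continuousOn.continuousAt (hU.mem_nhds hpU))
  have hmem : ∀ᶠ a in 𝓝 p.1, (a, f a) ∈ W' := by
    refine hc.eventually_mem (hW'.mem_nhds ?_)
    rw [hfp]
    exact hpW'
  filter_upwards [hmem, hU.mem_nhds hpU] with a ha haU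
  have h1 : (a, f a) ∈ S ∩ W := h ▸ ⟨a, haU, rfl⟩
  have h2 : (a, f a) ∈ (fun a => (a, g a)) '' U' := h' ▸ ⟨h1.1, ha⟩
  obtain ⟨b, -, hb⟩ := h2
  simp only [Prod.mk.injEq] at hb
  obtain ⟨rfl, hb⟩ := hb
  exact hb.symm

theorem IsLocalSolutionMap.riceConditionNumber_eq {S : Set (E × F)} {p : E × F} {f g : E → F}
    (Y : Set F) (hp : p ∈ S) (hf : IsLocalSolutionMap S p f) (hg : IsLocalSolutionMap S p g) :
    riceConditionNumber Y f p.1 = riceConditionNumber Y g p.1 := by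
  have h := hf.eventuallyEq hp hg
  refine limsup_congr ?_
  filter_upwards [h.filter_mono nhdsWithin_le_nhds] with a ha
  rw [ha, h.self_of_nhds]

end Condition

section Curvature

variable {E : Type*} [NormedAddCommGroup E] [InnerProductSpace ℝ E] [FiniteDimensional ℝ E]

/-- The normal space of `M` at `x`. -/
noncomputable def normalSpaceOf (M : Set E) (x : E) : Submodule ℝ E := (tangentSpaceOf M x)ᗮ

/-- The derivative at `x`, along tangent vectors of the submanifold `M`, of a vector field `X`
along `M` with values in the ambient space, followed by the orthogonal projection to the tangent
space. Derivatives within `M` are uniquely determined on tangent vectors of `M`. -/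
noncomputable def tangentialDeriv (M : Set E) (X : E → E) (x : E) :
    tangentSpaceOf M x →L[ℝ] tangentSpaceOf M x :=
  (tangentSpaceOf M x).orthogonalProjectionOnto ∘L fderivWithin ℝ X M x ∘L (tangentSpaceOf M x).subtypeL

/-- The shape operator (Weingarten map) `S_η` of `M` at `x` for a normal vector `η` at `x`:
`S_η v` is the tangential part of `-D_v N`, where `N` is the normal vector field
`y ↦ P_{N_y M} η` along `M`, which extends `η`. -/
noncomputable def weingartenMap (M : Set E) (x η : E) :
    tangentSpaceOf M x →L[ℝ] tangentSpaceOf M x :=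
  -tangentialDeriv M (fun y => (normalSpaceOf M y).starProjection η) x

/-- The Riemannian gradient at `y ∈ M` of the restriction to `M` of a function `f` on the
ambient space. -/
noncomputable def riemannianGradient (M : Set E) (f : E → ℝ) (y : E) : E :=
  (tangentSpaceOf M y).starProjection (gradient f y)

/-- The Riemannian Hessian at `x ∈ M` of the restriction to `M` of a function `f` on the
ambient space. -/
noncomputable def riemannianHessian (M : Set E) (f : E → ℝ) (x : E) :
    tangentSpaceOf M x →L[ℝ] tangentSpaceOf M x :=
  tangentialDeriv M (riemannianGradient M f) x

/-- The Riemannian Hessian `H_η` at `x ∈ M` of `y ↦ ‖y - a‖² / 2` on `M`, where `η = a - x`. -/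
noncomputable def distHessian (M : Set E) (a x : E) :
    tangentSpaceOf M x →L[ℝ] tangentSpaceOf M x :=
  riemannianHessian M (fun y => 1 / 2 * ‖y - a‖ ^ 2) x

/-- The critical point locus of `M`: pairs `(a, x)` with `x ∈ M` and `a - x` normal to `M`
at `x`. -/
def criticalPointLocus (M : Set E) : Set (E × E) :=
  {p | p.2 ∈ M ∧ p.1 - p.2 ∈ normalSpaceOf M p.2}

/-- The well-posed tuples of the critical point problem. -/
def wellPosedLocus (M : Set E) : Set (E × E) :=
  {p ∈ criticalPointLocus M | Function.Bijective (inputProjDeriv (criticalPointLocus M) p)}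

end Curvature

open Classical in
/-- The spectral norm of the inverse of `A`, with the value `∞` if `A` is not invertible. -/
noncomputable def spectralNormOfInverse {T : Type*} [NormedAddCommGroup T] [NormedSpace ℝ T]
    (A : T →L[ℝ] T) : ℝ≥0∞ :=
  if IsUnit A then ‖Ring.inverse A‖ₑ else ⊤

/-! Choose a chart `Φ` that straightens `M` to T, its tangent space at `x`, with `Φ x = 0` and
identity derivative at `x`. Let B be the second derivative of `Φ.symm` at `0`, P the orthogonal
projection to T, and η = a - x. For y in `M` near `x` and z in T, the vectors `fderiv ℝ Φ.symm (Φ y)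
z` form a moving tangent frame whose derivative at `x` in direction v is B(v, z). Tangency and
normality can be tested against this frame and differentiated by the product rule.

For the gradient field this gives ⟨Hv, z⟩ = ⟨v, z⟩ - ⟨η, B(v, z)⟩ (`inner_distHessian`), for the
normal field ⟨S_η v, z⟩ = ⟨η, B(v, z)⟩ (`inner_weingartenMap`); hence H = 1 - S_η. Symmetry of B
makes S_η self-adjoint.

Along curves in the critical locus the same computation gives H ẋ = P ȧ (`distHessian_snd`). If H is
injective, the implicit function theorem yields a local solution map, with derivative H⁻¹P;
conversely, an invertible input projection makes H surjective. The condition number of a C¹ map is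
the operator norm of its derivative, and ‖H⁻¹P‖ = ‖H⁻¹‖. An eigenbasis of S_w diagonalises H and
gives the curvature formula. -/

/-! ### Slice charts and tangent spaces -/

section SliceChart

variable {E : Type*} [NormedAddCommGroup E] [NormedSpace ℝ E]

/-- `Φ` is a smooth diffeomorphism between open sets that straightens `M` to the subspace `V`. -/
structure IsSliceChart (M : Set E) (V : Submodule ℝ E) (Φ : OpenPartialHomeomorph E E) :
    Prop where
  contDiffOn : ContDiffOn ℝ ∞ Φ Φ.source
  contDiffOn_symm : ContDiffOn ℝ ∞ Φ.symm Φ.target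
  mem_iff : ∀ y ∈ Φ.source, y ∈ M ↔ Φ y ∈ V

namespace IsSliceChart

variable {M : Set E} {V : Submodule ℝ E} {Φ : OpenPartialHomeomorph E E}

theorem contDiffAt (h : IsSliceChart M V Φ) {y : E} (hy : y ∈ Φ.source) : ContDiffAt ℝ ∞ Φ y :=
  h.contDiffOn.contDiffAt (Φ.open_source.mem_nhds hy)

theorem contDiffAt_symm (h : IsSliceChart M V Φ) {e : E} (he : e ∈ Φ.target) :
    ContDiffAt ℝ ∞ Φ.symm e :=
  h.contDiffOn_symm.contDiffAt (Φ.open_target.mem_nhds he)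

theorem hasFDerivAt (h : IsSliceChart M V Φ) {y : E} (hy : y ∈ Φ.source) :
    HasFDerivAt Φ (fderiv ℝ Φ y) y :=
  ((h.contDiffAt hy).differentiableAt (by simp)).hasFDerivAt

theorem hasFDerivAt_symm (h : IsSliceChart M V Φ) {e : E} (he : e ∈ Φ.target) :
    HasFDerivAt Φ.symm (fderiv ℝ Φ.symm e) e :=
  ((h.contDiffAt_symm he).differentiableAt (by simp)).hasFDerivAt

theorem fderiv_symm_comp_fderiv (h : IsSliceChart M V Φ) {y : E} (hy : y ∈ Φ.source) :
    (fderiv ℝ Φ.symm (Φ y)).comp (fderiv ℝ Φ y) = ContinuousLinearMap.id ℝ E := by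
  have h1 := (h.hasFDerivAt_symm (Φ.map_source hy)).comp y (h.hasFDerivAt hy)
  refine h1.unique ((hasFDerivAt_id y).congr_of_eventuallyEq ?_)
  filter_upwards [Φ.open_source.mem_nhds hy] with z hz using Φ.left_inv hz

theorem fderiv_comp_fderiv_symm (h : IsSliceChart M V Φ) {y : E} (hy : y ∈ Φ.source) :
    (fderiv ℝ Φ y).comp (fderiv ℝ Φ.symm (Φ y)) = ContinuousLinearMap.id ℝ E := by
  have h0 : HasFDerivAt Φ (fderiv ℝ Φ y) (Φ.symm (Φ y)) := by
    rw [Φ.left_inv hy]; exact h.hasFDerivAt hy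
  have h1 := h0.comp (Φ y) (h.hasFDerivAt_symm (Φ.map_source hy))
  refine h1.unique ((hasFDerivAt_id _).congr_of_eventuallyEq ?_)
  filter_upwards [Φ.open_target.mem_nhds (Φ.map_source hy)] with z hz using Φ.right_inv hz

/-- The differential of a slice chart as a linear equivalence. -/
noncomputable def fderivEquiv (h : IsSliceChart M V Φ) {y : E} (hy : y ∈ Φ.source) : E ≃L[ℝ] E :=
  ContinuousLinearEquiv.equivOfInverse (fderiv ℝ Φ y) (fderiv ℝ Φ.symm (Φ y))
    (fun v => congrArg (· v) (h.fderiv_symm_comp_fderiv hy))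
    (fun v => congrArg (· v) (h.fderiv_comp_fderiv_symm hy))

/-- The curve in `M` that a slice chart maps to a straight line. -/
theorem curve (h : IsSliceChart M V Φ) {y : E} (hy : y ∈ Φ.source) (hyM : y ∈ M) {v : E}
    (hv : v ∈ V) : ∃ ε > 0,
      ContDiffOn ℝ ∞ (fun s : ℝ => Φ.symm (Φ y + s • v)) (Ioo (-ε) ε) ∧
      (∀ s ∈ Ioo (-ε) ε, Φ.symm (Φ y + s • v) ∈ M) ∧ Φ.symm (Φ y + (0 : ℝ) • v) = y ∧
      HasDerivAt (fun s : ℝ => Φ.symm (Φ y + s • v)) (fderiv ℝ Φ.symm (Φ y) v) 0 := by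
  have hl : ContDiff ℝ ∞ (fun s : ℝ => Φ y + s • v) := by fun_prop
  have hm : ∀ᶠ s : ℝ in 𝓝 0, Φ y + s • v ∈ Φ.target := by
    refine hl.continuous.continuousAt.eventually_mem (Φ.open_target.mem_nhds ?_)
    simpa using Φ.map_source hy
  obtain ⟨ε, hε, hs⟩ := Metric.eventually_nhds_iff_ball.1 hm
  rw [Real.ball_eq_Ioo, zero_sub, zero_add] at hs
  refine ⟨ε, hε, h.contDiffOn_symm.comp hl.contDiffOn hs, fun s hs' => ?_, ?_, ?_⟩
  · rw [h.mem_iff _ (Φ.map_target (hs s hs')), Φ.right_inv (hs s hs')]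
    exact V.add_mem ((h.mem_iff y hy).1 hyM) (V.smul_mem _ hv)
  · simp [Φ.left_inv hy]
  · have h1 : HasFDerivAt Φ.symm (fderiv ℝ Φ.symm (Φ y)) (Φ y + (0 : ℝ) • v) := by
      simpa using h.hasFDerivAt_symm (Φ.map_source hy)
    have h2 : HasDerivAt (fun s : ℝ => Φ y + s • v) v 0 := by
      simpa using ((hasDerivAt_id (0 : ℝ)).smul_const v).const_add (Φ y)
    exact h1.comp_hasDerivAt 0 h2

theorem tangentSpaceOf_eq [FiniteDimensional ℝ E] (h : IsSliceChart M V Φ) {y : E}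
    (hy : y ∈ Φ.source) (hyM : y ∈ M) :
    tangentSpaceOf M y = V.map (fderiv ℝ Φ.symm (Φ y) : E →ₗ[ℝ] E) := by
  apply le_antisymm
  · refine Submodule.span_le.2 ?_
    rintro v ⟨γ, ε, hε, -, hγM, hγ0, hγ⟩
    refine ⟨fderiv ℝ Φ y v, ?_, congrArg (· v) (h.fderiv_symm_comp_fderiv hy)⟩
    subst hγ0
    have h1 : HasDerivAt (fun t => Φ (γ t)) (fderiv ℝ Φ (γ 0) v) 0 :=
      (h.hasFDerivAt hy).comp_hasDerivAt 0 hγ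
    -- The difference quotients of `Φ ∘ γ` lie in `V`, so closedness puts their limit there.
    have hV : IsClosed (V : Set E) := V.closed_of_finiteDimensional
    refine hV.mem_of_tendsto h1.tendsto_slope ?_
    have h2 : ∀ᶠ t in 𝓝 (0 : ℝ), γ t ∈ Φ.source :=
      hγ.continuousAt.eventually_mem (Φ.open_source.mem_nhds hy)
    filter_upwards [nhdsWithin_le_nhds h2,
      nhdsWithin_le_nhds (Ioo_mem_nhds (neg_lt_zero.2 hε) hε)] with t ht1 ht2
    rw [slope_def_module]
    exact V.smul_mem _ (V.sub_mem ((h.mem_iff _ ht1).1 (hγM t ht2)) ((h.mem_iff _ hy).1 hyM))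
  · rintro _ ⟨v, hv, rfl⟩
    obtain ⟨ε, hε, h1, h2, h3, h4⟩ := h.curve hy hyM hv
    exact Submodule.subset_span ⟨_, ε, hε, h1, h2, h3, h4⟩

end IsSliceChart

/-- `Φ` is a slice chart of `M` centred at `x` that is tangent to the identity at `x`. -/
structure IsAdaptedChart (M : Set E) (x : E) (Φ : OpenPartialHomeomorph E E) : Prop
    extends IsSliceChart M (tangentSpaceOf M x) Φ where
  mem : x ∈ M
  mem_source : x ∈ Φ.source
  map_base : Φ x = 0
  fderiv_base : fderiv ℝ Φ x = ContinuousLinearMap.id ℝ E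

namespace IsAdaptedChart

variable {M : Set E} {x : E} {Φ : OpenPartialHomeomorph E E}

theorem zero_mem_target (h : IsAdaptedChart M x Φ) : (0 : E) ∈ Φ.target :=
  h.map_base ▸ Φ.map_source h.mem_source

theorem fderiv_symm_zero (h : IsAdaptedChart M x Φ) :
    fderiv ℝ Φ.symm 0 = ContinuousLinearMap.id ℝ E := by
  simpa [h.map_base, h.fderiv_base] using h.fderiv_comp_fderiv_symm h.mem_source

theorem hasFDerivAt_base (h : IsAdaptedChart M x Φ) :
    HasFDerivAt Φ (ContinuousLinearMap.id ℝ E) x :=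
  h.fderiv_base ▸ h.hasFDerivAt h.mem_source

theorem contDiffOn_fderiv_symm (h : IsAdaptedChart M x Φ) :
    ContDiffOn ℝ ∞ (fderiv ℝ Φ.symm) Φ.target :=
  h.contDiffOn_symm.fderiv_of_isOpen Φ.open_target (by simp)

theorem hasFDerivAt_fderiv_symm (h : IsAdaptedChart M x Φ) :
    HasFDerivAt (fun y => fderiv ℝ Φ.symm (Φ y)) (fderiv ℝ (fderiv ℝ Φ.symm) 0) x := by
  have h1 : HasFDerivAt (fderiv ℝ Φ.symm) (fderiv ℝ (fderiv ℝ Φ.symm) 0) (Φ x) := by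
    rw [h.map_base]
    exact ((h.contDiffOn_fderiv_symm.contDiffAt (Φ.open_target.mem_nhds h.zero_mem_target)
      ).differentiableAt (by simp)).hasFDerivAt
  exact h1.comp x h.hasFDerivAt_base

theorem fderiv_fderiv_symm_comm (h : IsAdaptedChart M x Φ) (v z : E) :
    fderiv ℝ (fderiv ℝ Φ.symm) 0 v z = fderiv ℝ (fderiv ℝ Φ.symm) 0 z v :=
  (h.contDiffAt_symm h.zero_mem_target).isSymmSndFDerivAt
    (by
    rw [minSmoothness_of_isRCLikeNormedField]
    exact WithTop.coe_le_coe.2 (le_top : (2 : ℕ∞) ≤ ⊤)) v z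

end IsAdaptedChart

/-- Any slice chart becomes adapted after composition with the affine map e ↦ (DΦ_x)⁻¹(e - Φ x),
which carries the model subspace `V` onto the tangent space. -/
theorem IsEmbeddedSubmanifold.exists_isAdaptedChart [FiniteDimensional ℝ E] {m : ℕ} {M : Set E}
    (hM : IsEmbeddedSubmanifold m M) {x : E} (hx : x ∈ M) :
    Module.finrank ℝ (tangentSpaceOf M x) = m ∧ ∃ Φ, IsAdaptedChart M x Φ := by
  obtain ⟨Φ, V, hxs, h1, h2, hV, hMV⟩ := hM x hx
  have h : IsSliceChart M V Φ := ⟨h1, h2, hMV⟩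
  have hT := h.tangentSpaceOf_eq hxs hx
  set D := h.fderivEquiv hxs with hD
  have hinj : Function.Injective (fderiv ℝ Φ.symm (Φ x) : E →ₗ[ℝ] E) := D.symm.injective
  refine ⟨?_, ?_⟩
  · rw [hT, ← hV]
    exact (LinearEquiv.finrank_eq (Submodule.equivMapOfInjective _ hinj V)).symm
  let A : E ≃ₜ E := (Homeomorph.subRight (Φ x)).trans D.symm.toHomeomorph
  have hA : ContDiff ℝ ∞ A := D.symm.contDiff.comp (contDiff_id.sub contDiff_const)
  have hA' : ContDiff ℝ ∞ A.symm := by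
    have : ContDiff ℝ ∞ (fun e => D e + Φ x) := D.contDiff.add contDiff_const
    exact this
  refine ⟨Φ.transHomeomorph A, ⟨⟨?_, ?_, ?_⟩, hx, hxs, ?_, ?_⟩⟩
  · exact hA.comp_contDiffOn h1
  · exact h2.comp hA'.contDiffOn (fun e he => he)
  · intro y hy
    have hxV := (h.mem_iff x hxs).1 hx
    rw [h.mem_iff y hy, hT]
    change _ ↔ D.symm (Φ y - Φ x) ∈ V.map _
    refine ⟨fun hyV => ⟨_, V.sub_mem hyV hxV, rfl⟩, ?_⟩
    rintro ⟨v, hv, hvy⟩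
    have : v = Φ y - Φ x := hinj hvy
    rw [this] at hv
    simpa using V.add_mem hv hxV
  · change D.symm (Φ x - Φ x) = 0
    simp
  · have h3 : HasFDerivAt (fun y => D.symm (Φ y - Φ x))
        ((D.symm : E →L[ℝ] E).comp (fderiv ℝ Φ x)) x :=
      D.symm.hasFDerivAt.comp x ((h.hasFDerivAt hxs).sub_const (Φ x))
    exact h3.fderiv.trans (h.fderiv_symm_comp_fderiv hxs)

end SliceChart

/-! ### Orthogonal projections via the normal equations -/

section Projection

variable {E F : Type*} [NormedAddCommGroup E] [InnerProductSpace ℝ E] [FiniteDimensional ℝ E]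
  [NormedAddCommGroup F] [InnerProductSpace ℝ F] [FiniteDimensional ℝ F]

/-- The adjoint of operators between real spaces as a continuous linear map. -/
noncomputable def realAdjoint (F E : Type*) [NormedAddCommGroup E] [InnerProductSpace ℝ E]
    [FiniteDimensional ℝ E] [NormedAddCommGroup F] [InnerProductSpace ℝ F]
    [FiniteDimensional ℝ F] : (F →L[ℝ] E) →L[ℝ] (E →L[ℝ] F) where
  toFun A := haveI := FiniteDimensional.complete ℝ E; haveI := FiniteDimensional.complete ℝ F
    ContinuousLinearMap.adjoint A
  map_add' A B := map_add _ A B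
  map_smul' c A := by simp
  cont := LinearIsometryEquiv.continuous _

theorem inner_realAdjoint_left (A : F →L[ℝ] E) (u : E) (z : F) :
    inner ℝ (realAdjoint F E A u) z = inner ℝ u (A z) :=
  haveI := FiniteDimensional.complete ℝ E; haveI := FiniteDimensional.complete ℝ F
  ContinuousLinearMap.adjoint_inner_left A z u

/-- The least-squares formula A(A*A)⁻¹A*. It expresses the projection through operations that
preserve differentiability in `A`. -/
theorem starProjection_range_eq (A : F →L[ℝ] E) (hA : IsUnit (realAdjoint F E A ∘L A :
      F →L[ℝ] F)) {K : Submodule ℝ E} (hK : K = LinearMap.range (A : F →ₗ[ℝ] E)) :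
    K.starProjection = A ∘L (Ring.inverse (realAdjoint F E A ∘L A) ∘L realAdjoint F E A) := by
  subst hK
  ext u
  refine Submodule.eq_starProjection_of_mem_orthogonal ⟨_, rfl⟩ ?_
  rw [Submodule.mem_orthogonal']
  rintro _ ⟨z, rfl⟩
  have h1 : (realAdjoint F E A ∘L A) * Ring.inverse (realAdjoint F E A ∘L A) = 1 :=
    Ring.mul_inverse_cancel _ hA
  have h2 := congrArg (· (realAdjoint F E A u)) h1
  change inner ℝ _ (A z) = 0
  rw [← inner_realAdjoint_left, map_sub, inner_sub_left, sub_eq_zero]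
  exact congrArg (inner ℝ · z) h2.symm

end Projection

/-! ### Hessian and Weingarten map through the second derivative of the chart -/

namespace IsAdaptedChart

variable {E : Type*} [NormedAddCommGroup E] [InnerProductSpace ℝ E] [FiniteDimensional ℝ E]
  {M : Set E} {x : E} {Φ : OpenPartialHomeomorph E E}

theorem fderiv_symm_mem_tangentSpaceOf (h : IsAdaptedChart M x Φ) {y z : E} (hy : y ∈ Φ.source)
    (hyM : y ∈ M) (hz : z ∈ tangentSpaceOf M x) :
    fderiv ℝ Φ.symm (Φ y) z ∈ tangentSpaceOf M y := by
  rw [h.tangentSpaceOf_eq hy hyM]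
  exact ⟨z, hz, rfl⟩

/-- The tangential projection of a submanifold is differentiable. -/
theorem differentiableWithinAt_starProjection (h : IsAdaptedChart M x Φ) :
    DifferentiableWithinAt ℝ (fun y => (tangentSpaceOf M y).starProjection) M x := by
  set T := tangentSpaceOf M x with hT
  have := FiniteDimensional.complete ℝ T
  -- For y in `M`, `A y` maps the fixed space `T` onto the tangent space at y. Its Gram operator `G
  -- y` is the identity at `x`, hence invertible nearby.
  let A : E → T →L[ℝ] E := fun y => fderiv ℝ Φ.symm (Φ y) ∘L T.subtypeL
  let G : E → T →L[ℝ] T := fun y => realAdjoint T E (A y) ∘L A y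
  have hA : DifferentiableAt ℝ A x :=
    h.hasFDerivAt_fderiv_symm.differentiableAt.clm_comp (differentiableAt_const _)
  have hAd : DifferentiableAt ℝ (fun y => realAdjoint T E (A y)) x :=
    (realAdjoint T E).differentiableAt.comp x hA
  have hG : DifferentiableAt ℝ G x := hAd.clm_comp hA
  have hAx : A x = T.subtypeL := by
    ext z; simp [A, h.map_base, h.fderiv_symm_zero]
  have hGx : G x = 1 := by
    ext z
    refine congrArg Subtype.val (ext_inner_right ℝ fun w => ?_)
    simp only [G, ContinuousLinearMap.comp_apply, inner_realAdjoint_left, hAx]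
    rfl
  have hU : IsUnit (G x) := hGx ▸ isUnit_one
  have hUe : ∀ᶠ y in 𝓝 x, IsUnit (G y) :=
    (hG.continuousAt.tendsto).eventually ((Units.isOpen (R := T →L[ℝ] T)).mem_nhds hU)
  have hI : DifferentiableAt ℝ (fun y => Ring.inverse (G y)) x :=
    DifferentiableAt.inverse (𝕜 := ℝ) (R := T →L[ℝ] T) (h := G) hG hU
  have hP := (hA.clm_comp (hI.clm_comp hAd)).differentiableWithinAt (s := M)
  have key : ∀ y ∈ Φ.source, y ∈ M → IsUnit (G y) → (tangentSpaceOf M y).starProjection =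
      A y ∘L (Ring.inverse (G y) ∘L realAdjoint T E (A y)) := by
    intro y hy hyM hyU
    refine starProjection_range_eq (A y) hyU ?_
    rw [h.tangentSpaceOf_eq hy hyM]
    ext w
    simp [A, hT]
  refine hP.congr_of_eventuallyEq ?_ (key x h.mem_source h.mem hU)
  filter_upwards [self_mem_nhdsWithin, nhdsWithin_le_nhds hUe,
    nhdsWithin_le_nhds (Φ.open_source.mem_nhds h.mem_source)] with y hyM hyU hy
  exact key y hy hyM hyU

/-- The tangential derivative of a vector field `X` along `M` whose tangential part is that of
`Z`, in terms of the second derivative of the inverse of an adapted chart. -/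
theorem inner_tangentialDeriv (h : IsAdaptedChart M x Φ) {X Z : E → E} {Z' : E →L[ℝ] E}
    (hX : DifferentiableWithinAt ℝ X M x) (hZ : HasFDerivAt Z Z' x)
    (hXZ : ∀ y ∈ M, ∀ w ∈ tangentSpaceOf M y, inner ℝ (X y) w = inner ℝ (Z y) w)
    (v z : tangentSpaceOf M x) :
    inner ℝ (tangentialDeriv M X x v) z = inner ℝ (Z' v) (z : E) +
      inner ℝ (Z x - X x) (fderiv ℝ (fderiv ℝ Φ.symm) 0 v z) := by
  obtain ⟨ε, hε, -, hγM, hγ0, hγ⟩ := h.curve h.mem_source h.mem v.2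
  set γ : ℝ → E := fun s => Φ.symm (Φ x + s • (v : E)) with hγdef
  rw [h.map_base, h.fderiv_symm_zero, ContinuousLinearMap.id_apply] at hγ
  change γ 0 = x at hγ0
  have hI : Ioo (-ε) ε ∈ 𝓝 (0 : ℝ) := Ioo_mem_nhds (neg_lt_zero.2 hε) hε
  have hXγ : HasDerivAt (fun s => X (γ s)) (fderivWithin ℝ X M x v) 0 := by
    refine HasDerivWithinAt.hasDerivAt (s := Ioo (-ε) ε) ?_ hI
    refine HasFDerivWithinAt.comp_hasDerivWithinAt (t := M) 0 ?_ hγ.hasDerivWithinAt hγM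
    rw [hγ0]
    exact hX.hasFDerivWithinAt
  have hZγ : HasDerivAt (fun s => Z (γ s)) (Z' v) 0 :=
    HasFDerivAt.comp_hasDerivAt 0 (hγ0.symm ▸ hZ) hγ
  have hAγ : HasDerivAt (fun s => fderiv ℝ Φ.symm (Φ (γ s)) (z : E))
      (fderiv ℝ (fderiv ℝ Φ.symm) 0 v z) 0 := by
    have h1 : HasDerivAt (fun s => fderiv ℝ Φ.symm (Φ (γ s)))
        (fderiv ℝ (fderiv ℝ Φ.symm) 0 v) 0 := by
      refine HasFDerivAt.comp_hasDerivAt (f := γ) (l := fun y => fderiv ℝ Φ.symm (Φ y)) 0 ?_ hγ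
      rw [hγ0]
      exact h.hasFDerivAt_fderiv_symm
    simpa using h1.clm_apply (hasDerivAt_const (0 : ℝ) (z : E))
  have hs : ∀ᶠ s in 𝓝 (0 : ℝ), γ s ∈ Φ.source :=
    hγ.continuousAt.eventually_mem (Φ.open_source.mem_nhds (hγ0.symm ▸ h.mem_source))
  -- Against the moving tangent vector, `X` and `Z` have equal inner products along γ; the product
  -- rule on both sides produces the second-derivative term.
  have heq := (hXγ.inner ℝ hAγ).unique ((hZγ.inner ℝ hAγ).congr_of_eventuallyEq (by
    filter_upwards [hI, hs] with s hs1 hs2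
    exact hXZ _ (hγM s hs1) _ (h.fderiv_symm_mem_tangentSpaceOf hs2 (hγM s hs1) z.2)))
  simp only [hγ0, h.map_base, h.fderiv_symm_zero, ContinuousLinearMap.id_apply] at heq
  have h2 : inner ℝ (tangentialDeriv M X x v) z = inner ℝ (fderivWithin ℝ X M x v) (z : E) := by
    rw [real_inner_comm, tangentialDeriv]
    exact (Submodule.inner_orthogonalProjectionOnto_eq_of_mem_left _ _).trans
      (real_inner_comm _ _)
  rw [h2, inner_sub_left]
  linarith

/-- The gradient is the tangential part of y - a and vanishes at `x`, so in `inner_tangentialDeriv`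
with Z = y - a only the term of Z(x) = -(a - x) multiplies the second derivative. -/
theorem inner_distHessian (h : IsAdaptedChart M x Φ) {a : E}
    (ha : a - x ∈ normalSpaceOf M x) (v z : tangentSpaceOf M x) :
    inner ℝ (distHessian M a x v) z = inner ℝ v z -
      inner ℝ (a - x) (fderiv ℝ (fderiv ℝ Φ.symm) 0 v z) := by
  have hg : ∀ y, gradient (fun y : E => 1 / 2 * ‖y - a‖ ^ 2) y = y - a := by
    intro y
    refine HasGradientAt.gradient ?_
    rw [hasGradientAt_iff_hasFDerivAt]
    have h1 := (((hasFDerivAt_id (𝕜 := ℝ) y).sub_const a).norm_sq).const_mul (1 / 2 : ℝ)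
    refine h1.congr_fderiv ?_
    ext w
    simp
  have hgrad : riemannianGradient M (fun y => 1 / 2 * ‖y - a‖ ^ 2) =
      fun y => (tangentSpaceOf M y).starProjection (y - a) := by
    funext y
    rw [riemannianGradient, hg]
  have hx0 : (tangentSpaceOf M x).starProjection (x - a) = 0 := by
    rw [Submodule.starProjection_apply_eq_zero_iff, ← neg_sub]
    exact Submodule.neg_mem _ ha
  have hid : HasFDerivAt (fun y : E => y - a) (ContinuousLinearMap.id ℝ E) x :=
    (hasFDerivAt_id x).sub_const a
  rw [distHessian, riemannianHessian, hgrad, h.inner_tangentialDeriv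
    (h.differentiableWithinAt_starProjection.clm_apply hid.differentiableAt.differentiableWithinAt)
    hid, hx0, sub_zero, ← neg_sub a x, inner_neg_left, ← sub_eq_add_neg]
  · rfl
  · intro y _ w hw
    rw [Submodule.inner_starProjection_left_eq_right, Submodule.starProjection_eq_self_iff.2 hw]

/-- A normal field has zero tangential part, so `inner_tangentialDeriv` applies with Z = 0. -/
theorem inner_weingartenMap (h : IsAdaptedChart M x Φ) {η : E}
    (hη : η ∈ normalSpaceOf M x) (v z : tangentSpaceOf M x) :
    inner ℝ (weingartenMap M x η v) z =
      inner ℝ η (fderiv ℝ (fderiv ℝ Φ.symm) 0 v z) := by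
  have hN : ∀ y, (normalSpaceOf M y).starProjection η =
      η - (tangentSpaceOf M y).starProjection η := fun y =>
    congrArg (· η) (Submodule.starProjection_orthogonal' (tangentSpaceOf M y))
  have hd : DifferentiableWithinAt ℝ (fun y => (normalSpaceOf M y).starProjection η) M x := by
    simp only [hN]
    exact (differentiableWithinAt_const η).sub
      (h.differentiableWithinAt_starProjection.clm_apply (differentiableWithinAt_const η))
  have hη' : (normalSpaceOf M x).starProjection η = η :=
    Submodule.starProjection_eq_self_iff.2 hη
  rw [weingartenMap, neg_apply, inner_neg_left,
    h.inner_tangentialDeriv hd (hasFDerivAt_const 0 x), hη']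
  · simp
  · intro y _ w hw
    rw [inner_zero_left, real_inner_comm]
    exact Submodule.inner_right_of_mem_orthogonal hw (Submodule.starProjection_apply_mem _ _)

end IsAdaptedChart

/-! ### Rice's condition number of a C¹ map -/

section RiceConditionNumber

variable {E F : Type*} [NormedAddCommGroup E] [NormedSpace ℝ E]
  [NormedAddCommGroup F] [NormedSpace ℝ F]

theorem edist_le_riemannianDistOn (Y : Set F) (p q : F) : edist p q ≤ riemannianDistOn Y p q := by
  refine le_iInf₂ fun γ hγ => ?_
  obtain ⟨h1, -, rfl, rfl⟩ := hγ
  rw [edist_comm, edist_eq_enorm_sub]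
  exact enorm_sub_le_lintegral_derivWithin_Icc_of_contDiffOn_Icc h1 zero_le_one

/-- The image of the segment is a competing curve in `Y`, with speed at most `c * edist a a'`. -/
theorem riemannianDistOn_le_of_segment {Y : Set F} {f : E → F} {U : Set E} (hU : IsOpen U)
    (hf : ContDiffOn ℝ 1 f U) (hY : ∀ b ∈ U, f b ∈ Y) {a a' : E} (hs : segment ℝ a a' ⊆ U)
    {c : ℝ≥0∞} (hc : ∀ b ∈ segment ℝ a a', ‖fderiv ℝ f b‖ₑ ≤ c) :
    riemannianDistOn Y (f a) (f a') ≤ c * edist a a' := by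
  have hl : ContDiff ℝ 1 (fun t : ℝ => a + t • (a' - a)) := by fun_prop
  have hm : ∀ t ∈ Icc (0 : ℝ) 1, a + t • (a' - a) ∈ segment ℝ a a' := fun t ht => by
    rw [segment_eq_image']; exact ⟨t, ht, rfl⟩
  have h0 : ContDiffOn ℝ 1 (fun t : ℝ => f (a + t • (a' - a))) (Icc 0 1) :=
    hf.comp hl.contDiffOn fun t ht => hs (hm t ht)
  refine (iInf₂_le (fun t : ℝ => f (a + t • (a' - a)))
    ⟨h0, fun t ht => hY _ (hs (hm t ht)), by simp, by simp⟩).trans ?_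
  calc ∫⁻ t in Icc (0 : ℝ) 1,
        ‖derivWithin (fun t : ℝ => f (a + t • (a' - a))) (Icc 0 1) t‖ₑ
      ≤ ∫⁻ t in Icc (0 : ℝ) 1, c * edist a a' := by
        refine MeasureTheory.setLIntegral_mono' measurableSet_Icc fun t ht => ?_
        have h1 : HasFDerivAt f (fderiv ℝ f (a + t • (a' - a))) (a + t • (a' - a)) :=
          ((hf.contDiffAt (hU.mem_nhds (hs (hm t ht)))).differentiableAt (by simp)).hasFDerivAt
        have h2 : HasDerivAt (fun t : ℝ => a + t • (a' - a)) (a' - a) t := by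
          simpa using ((hasDerivAt_id t).smul_const (a' - a)).const_add a
        have h3 := (h1.comp_hasDerivAt t h2).hasDerivWithinAt (s := Icc 0 1)
        have h4 := h3.derivWithin (uniqueDiffOn_Icc zero_lt_one t ht)
        change derivWithin (fun t : ℝ => f (a + t • (a' - a))) _ _ = _ at h4
        rw [h4, edist_comm, edist_eq_enorm_sub]
        exact (ContinuousLinearMap.le_opENorm _ _).trans (by gcongr; exact hc _ (hm t ht))
    _ = c * edist a a' := by simp

/-- Rice's condition number of a continuously differentiable map is the norm of its derivative. -/
theorem riceConditionNumber_eq_enorm_fderiv {Y : Set F} {f : E → F} {U : Set E} (hU : IsOpen U)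
    (hf : ContDiffOn ℝ 1 f U) (hY : ∀ b ∈ U, f b ∈ Y) {a : E} (ha : a ∈ U) :
    riceConditionNumber Y f a = ‖fderiv ℝ f a‖ₑ := by
  apply le_antisymm
  · refine le_of_forall_gt_imp_ge_of_dense fun c hc => ?_
    have hcont : ContinuousAt (fun b => ‖fderiv ℝ f b‖ₑ) a :=
      ((hf.continuousOn_fderiv_of_isOpen hU le_rfl).continuousAt (hU.mem_nhds ha)).enorm
    obtain ⟨r, hr, hb⟩ := Metric.eventually_nhds_iff_ball.1
      ((hcont.eventually_lt_const hc).and (hU.mem_nhds ha))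
    refine limsup_le_of_le (by isBoundedDefault) ?_
    filter_upwards [nhdsWithin_le_nhds (Metric.ball_mem_nhds a hr)] with a' ha'
    have hs : segment ℝ a a' ⊆ Metric.ball a r :=
      (convex_ball a r).segment_subset (Metric.mem_ball_self hr) ha'
    exact ENNReal.div_le_of_le_mul (riemannianDistOn_le_of_segment hU hf hY
      (fun b hb' => (hb b (hs hb')).2) (fun b hb' => (hb b (hs hb')).1.le))
  · set L := riceConditionNumber Y f a with hL
    have hd : HasFDerivAt f (fderiv ℝ f a) a :=
      ((hf.contDiffAt (hU.mem_nhds ha)).differentiableAt (by simp)).hasFDerivAt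
    have key : ∀ v : E, v ≠ 0 → ‖fderiv ℝ f a v‖ₑ ≤ L * ‖v‖ₑ := by
      intro v hv
      have hl : HasDerivAt (fun s : ℝ => a + s • v) v 0 := by
        simpa using ((hasDerivAt_id (0 : ℝ)).smul_const v).const_add a
      have hfl : HasDerivAt (fun s : ℝ => f (a + s • v)) (fderiv ℝ f a v) 0 :=
        HasFDerivAt.comp_hasDerivAt (f := fun s : ℝ => a + s • v) 0 (by simpa using hd) hl
      have ht : Tendsto (fun s : ℝ => a + s • v) (𝓝[≠] 0) (𝓝[≠] a) := by
        refine tendsto_nhdsWithin_iff.2 ⟨?_, ?_⟩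
        · simpa using hl.continuousAt.tendsto.mono_left nhdsWithin_le_nhds
        · filter_upwards [self_mem_nhdsWithin] with s hs
          simpa [hv] using hs
      have h1 : Tendsto (fun s => ‖slope (fun s : ℝ => f (a + s • v)) 0 s‖ₑ) (𝓝[≠] 0)
          (𝓝 ‖fderiv ℝ f a v‖ₑ) := hfl.tendsto_slope.enorm
      have h2 : ‖fderiv ℝ f a v‖ₑ / ‖v‖ₑ ≤ L := by
        have h3 : Tendsto (fun s => ‖slope (fun s : ℝ => f (a + s • v)) 0 s‖ₑ / ‖v‖ₑ) (𝓝[≠] 0)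
            (𝓝 (‖fderiv ℝ f a v‖ₑ / ‖v‖ₑ)) :=
          ENNReal.Tendsto.div_const h1 (Or.inr (by simpa using hv))
        rw [← h3.limsup_eq, hL, riceConditionNumber]
        -- Restricting the approach to the line through `a` in direction `v` can only lower the
        -- limsup; there Euclidean distance already recovers the directional derivative.
        refine le_trans ?_ (limsup_le_limsup_of_le (f := map (fun s : ℝ => a + s • v) (𝓝[≠] 0)) ht)
        rw [← limsup_comp]
        refine limsup_le_limsup ?_
        filter_upwards [self_mem_nhdsWithin] with s hs
        have hs' : s ≠ 0 := hs
        have hse : ‖s‖ₑ ≠ 0 := by simpa using hs'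
        simp only [Function.comp_apply]
        refine le_trans (le_of_eq ?_) (ENNReal.div_le_div_right
          (edist_le_riemannianDistOn Y (f a) (f (a + s • v))) _)
        rw [slope_def_module, edist_comm (f a), edist_eq_enorm_sub, edist_comm a,
          edist_eq_enorm_sub, add_sub_cancel_left, enorm_smul, enorm_smul, sub_zero,
          zero_smul, add_zero, enorm_inv hs', ENNReal.div_eq_inv_mul, ENNReal.div_eq_inv_mul,
          ENNReal.mul_inv (Or.inl hse) (Or.inl enorm_ne_top)]
        ring
      rwa [ENNReal.div_le_iff (by simpa using hv) enorm_ne_top] at h2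
    rcases eq_or_ne L ⊤ with hT | hT
    · rw [hT]; exact le_top
    clear_value L
    lift L to NNReal using hT
    rw [enorm_eq_nnnorm, ENNReal.coe_le_coe]
    refine ContinuousLinearMap.opNNNorm_le_bound _ _ fun v => ?_
    rcases eq_or_ne v 0 with rfl | hv
    · simp
    · have := key v hv
      rw [enorm_eq_nnnorm, enorm_eq_nnnorm] at this
      exact_mod_cast this

end RiceConditionNumber

/-! ### Local solution maps from the implicit function theorem -/

section LocalSolutionMap

theorem exists_openPartialHomeomorph_of_injective_fderiv {X : Type*} [NormedAddCommGroup X]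
    [NormedSpace ℝ X] [FiniteDimensional ℝ X] {g : X → X} {O : Set X} (hO : IsOpen O)
    (hg : ContDiffOn ℝ ∞ g O) {p : X} (hp : p ∈ O) (hinj : Function.Injective (fderiv ℝ g p)) :
    ∃ G : OpenPartialHomeomorph X X, p ∈ G.source ∧ G.source ⊆ O ∧ ⇑G = g ∧
      ContDiffOn ℝ ∞ G.symm G.target := by
  have := FiniteDimensional.complete ℝ X
  let e : X ≃L[ℝ] X :=
    (LinearEquiv.ofInjectiveEndo (fderiv ℝ g p : X →ₗ[ℝ] X) hinj).toContinuousLinearEquiv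
  have he : (e : X →L[ℝ] X) = fderiv ℝ g p := by ext; rfl
  have hgp := hg.contDiffAt (hO.mem_nhds hp)
  have hd : HasFDerivAt g (e : X →L[ℝ] X) p :=
    he ▸ (hgp.differentiableAt (by simp)).hasFDerivAt
  let G₀ := hgp.toOpenPartialHomeomorph g hd (by simp)
  -- Restricting to points with invertible derivative makes the inverse smooth on the whole target,
  -- not only at the image of `p`.
  let O' := O ∩ fderiv ℝ g ⁻¹' range ((↑) : (X ≃L[ℝ] X) → X →L[ℝ] X)
  have hO' : IsOpen O' := (hg.continuousOn_fderiv_of_isOpen hO (by simp)).isOpen_inter_preimage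
    hO ContinuousLinearEquiv.isOpen
  let G := G₀.restrOpen O' hO'
  have hs : G.source ⊆ O' := inter_subset_right
  refine ⟨G, ⟨hgp.mem_toOpenPartialHomeomorph_source hd (by simp), hp, ⟨e, he⟩⟩,
    hs.trans inter_subset_left, rfl, fun b hb => ?_⟩
  obtain ⟨hbO, e', he'⟩ := hs (G.map_target hb)
  have hgb := hg.contDiffAt (hO.mem_nhds hbO)
  refine (G.contDiffAt_symm (f₀' := e') hb ?_ hgb).contDiffWithinAt
  rw [he']
  exact (hgb.differentiableAt (by simp)).hasFDerivAt

variable {E F : Type*} [NormedAddCommGroup E] [NormedSpace ℝ E]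
  [NormedAddCommGroup F] [NormedSpace ℝ F]

/-- Implicit function theorem: a zero locus whose defining map has an injective partial derivative
admits a smooth local solution map. -/
theorem exists_isLocalSolutionMap [FiniteDimensional ℝ E] [FiniteDimensional ℝ F]
    {S W : Set (E × F)} {K : E × F → F} {p : E × F} (hW : IsOpen W) (hpW : p ∈ W) (hpS : p ∈ S)
    (hK : ContDiffOn ℝ ∞ K W) (hS : ∀ q ∈ W, q ∈ S ↔ K q = 0)
    (hinj : ∀ v, fderiv ℝ K p (0, v) = 0 → v = 0) : ∃ f, IsLocalSolutionMap S p f := by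
  have hg : ContDiffOn ℝ ∞ (fun q : E × F => (q.1, K q)) W := contDiff_fst.contDiffOn.prodMk hK
  have hd : HasFDerivAt (fun q : E × F => (q.1, K q))
      ((ContinuousLinearMap.fst ℝ E F).prod (fderiv ℝ K p)) p :=
    hasFDerivAt_fst.prodMk
      (((hK.contDiffAt (hW.mem_nhds hpW)).differentiableAt (by simp)).hasFDerivAt)
  obtain ⟨G, hpG, hGW, hG, hGs⟩ := exists_openPartialHomeomorph_of_injective_fderiv hW hg hpW (by
    rw [hd.fderiv, injective_iff_map_eq_zero]
    rintro ⟨u, v⟩ huv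
    simp only [ContinuousLinearMap.prod_apply, Prod.mk_eq_zero] at huv
    obtain ⟨h1, h2⟩ := huv
    have h3 : u = 0 := h1
    subst h3
    rw [hinj v h2]
    rfl)
  have hGv : ∀ q, G q = (q.1, K q) := fun q => congrFun hG q
  have hj : ContDiff ℝ ∞ (fun b : E => (b, (0 : F))) := by fun_prop
  refine ⟨fun b => (G.symm (b, 0)).2, (fun b : E => (b, (0 : F))) ⁻¹' G.target, G.source,
    G.open_target.preimage hj.continuous, G.open_source, ?_, hpG, ?_, ?_⟩
  · have := G.map_source hpG
    rwa [hGv, (hS p hpW).1 hpS] at this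
  · exact contDiff_snd.comp_contDiffOn (hGs.comp hj.contDiffOn fun b hb => hb)
  · ext q
    constructor
    · rintro ⟨hqS, hqG⟩
      have h1 : G q = (q.1, 0) := by rw [hGv, (hS q (hGW hqG)).1 hqS]
      refine ⟨q.1, ?_, ?_⟩
      · change (q.1, (0 : F)) ∈ G.target
        exact h1 ▸ G.map_source hqG
      · simp only [← h1, G.left_inv hqG]
    · rintro ⟨b, hb, rfl⟩
      have hb' : (b, (0 : F)) ∈ G.target := hb
      have h1 := G.right_inv hb'
      rw [hGv, Prod.mk.injEq] at h1
      have h2 : (b, (G.symm (b, 0)).2) = G.symm (b, 0) := Prod.ext h1.1.symm rfl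
      simp only [h2]
      exact ⟨(hS _ (hGW (G.map_target hb'))).2 h1.2, G.map_target hb'⟩

theorem IsLocalSolutionMap.mk_fderiv_mem_tangentSpaceOf {S : Set (E × F)} {p : E × F} {f : E → F}
    (hp : p ∈ S) (hf : IsLocalSolutionMap S p f) (u : E) :
    (u, fderiv ℝ f p.1 u) ∈ tangentSpaceOf S p := by
  have hfp := hf.apply_eq hp
  obtain ⟨U, W, hU, -, hpU, -, hfs, h⟩ := hf
  have hl : ContDiff ℝ ∞ (fun s : ℝ => p.1 + s • u) := by fun_prop
  have hl' : HasDerivAt (fun s : ℝ => p.1 + s • u) u 0 := by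
    simpa using ((hasDerivAt_id (0 : ℝ)).smul_const u).const_add p.1
  have hm : ∀ᶠ s : ℝ in 𝓝 0, p.1 + s • u ∈ U :=
    hl.continuous.continuousAt.eventually_mem (hU.mem_nhds (by simpa using hpU))
  obtain ⟨ε, hε, hs⟩ := Metric.eventually_nhds_iff_ball.1 hm
  rw [Real.ball_eq_Ioo, zero_sub, zero_add] at hs
  refine Submodule.subset_span ⟨fun s => (p.1 + s • u, f (p.1 + s • u)), ε, hε,
    hl.contDiffOn.prodMk (hfs.comp hl.contDiffOn hs), fun s hs' => ?_, ?_, ?_⟩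
  · have : (p.1 + s • u, f (p.1 + s • u)) ∈ S ∩ W := h ▸ ⟨_, hs s hs', rfl⟩
    exact this.1
  · simp [hfp]
  · have hd : HasFDerivAt f (fderiv ℝ f p.1) (p.1 + (0 : ℝ) • u) := by
      simpa using ((hfs.contDiffAt (hU.mem_nhds hpU)).differentiableAt (by simp)).hasFDerivAt
    exact hl'.prodMk (hd.comp_hasDerivAt 0 hl')

theorem IsLocalSolutionMap.riceConditionNumber_eq_enorm_fderiv {S : Set (E × F)}
    {p : E × F} {f : E → F} {Y : Set F} (hf : IsLocalSolutionMap S p f)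
    (hS : ∀ q ∈ S, q.2 ∈ Y) : riceConditionNumber Y f p.1 = ‖fderiv ℝ f p.1‖ₑ := by
  obtain ⟨U, W, hU, -, hpU, -, hfs, h⟩ := hf
  refine _root_.riceConditionNumber_eq_enorm_fderiv hU (hfs.of_le (by simp)) (fun b hb => ?_) hpU
  have : (b, f b) ∈ S ∩ W := h ▸ ⟨b, hb, rfl⟩
  exact hS _ this.1

end LocalSolutionMap

/-! ### Spectral norm of the inverse of a diagonalisable operator -/

section SpectralNorm

variable {T : Type*} [NormedAddCommGroup T] [InnerProductSpace ℝ T] {ι : Type*} [Fintype ι]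

theorem OrthonormalBasis.inner_map_of_eigenbasis (b : OrthonormalBasis ι ℝ T) {A : T →L[ℝ] T}
    {d : ι → ℝ} (hA : ∀ i, A (b i) = d i • b i) (v : T) (i : ι) :
    inner ℝ (b i) (A v) = d i * inner ℝ (b i) v := by
  classical
  conv_lhs => rw [← b.sum_repr' v]
  simp [map_sum, inner_sum, hA, inner_smul_right, b.inner_eq_ite, mul_comm]

theorem spectralNormOfInverse_eq_iSup [FiniteDimensional ℝ T] (b : OrthonormalBasis ι ℝ T)
    {A : T →L[ℝ] T} {d : ι → ℝ} (hA : ∀ i, A (b i) = d i • b i) :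
    spectralNormOfInverse A = ⨆ i, (ENNReal.ofReal |d i|)⁻¹ := by
  have := FiniteDimensional.complete ℝ T
  simp_rw [← Real.enorm_eq_ofReal_abs]
  -- A zero eigenvalue makes both sides `⊤`. For an empty index type the supremum is `0`, in
  -- agreement with the norm on the zero space.
  by_cases hd : ∃ i, d i = 0
  · obtain ⟨i, hi⟩ := hd
    have hA' : ¬ IsUnit A := fun hU => by
      refine b.orthonormal.ne_zero i ((ContinuousLinearMap.isUnit_iff_bijective.1 hU).1 ?_)
      rw [hA, hi, zero_smul, map_zero]
    rw [spectralNormOfInverse, if_neg hA', eq_comm, eq_top_iff]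
    exact le_iSup_of_le i (by simp [hi])
  push Not at hd
  have hinj : Function.Injective A := by
    refine (injective_iff_map_eq_zero A).2 fun v hv => b.repr.map_eq_zero_iff.1 ?_
    ext i
    have h1 := b.inner_map_of_eigenbasis hA v i
    rw [hv, inner_zero_right, zero_eq_mul, or_iff_right (hd i)] at h1
    simpa [b.repr_apply_apply] using h1
  have hU : IsUnit A := ContinuousLinearMap.isUnit_iff_bijective.2
    ⟨hinj, LinearMap.injective_iff_surjective (f := (A : T →ₗ[ℝ] T)).1 hinj⟩
  rw [spectralNormOfInverse, if_pos hU]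
  set B := Ring.inverse A with hB
  have hAB : ∀ v, A (B v) = v := fun v => DFunLike.congr_fun (Ring.mul_inverse_cancel A hU) v
  apply le_antisymm
  · set L := ⨆ i, ‖d i‖ₑ⁻¹ with hL
    have hLi : ∀ i, ‖d i‖ₑ⁻¹ ≤ L := fun i => le_iSup (fun i => ‖d i‖ₑ⁻¹) i
    clear_value L
    rcases eq_or_ne L ⊤ with rfl | hT
    · exact le_top
    lift L to NNReal using hT
    rw [enorm_eq_nnnorm, ENNReal.coe_le_coe]
    refine ContinuousLinearMap.opNNNorm_le_bound _ _ fun v => ?_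
    rw [← NNReal.coe_le_coe, NNReal.coe_mul, coe_nnnorm, coe_nnnorm]
    refine le_of_sq_le_sq ?_ (by positivity)
    rw [mul_pow, ← b.sum_sq_norm_inner_right (B v), ← b.sum_sq_norm_inner_right v, Finset.mul_sum]
    refine Finset.sum_le_sum fun i _ => ?_
    rw [← mul_pow]
    refine pow_le_pow_left₀ (norm_nonneg _) ?_ 2
    have h1 := b.inner_map_of_eigenbasis hA (B v) i
    rw [hAB] at h1
    have h2 : ‖d i‖⁻¹ ≤ L := by
      have h3 := hLi i
      rw [← enorm_inv (hd i), enorm_eq_nnnorm, ENNReal.coe_le_coe, ← NNReal.coe_le_coe,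
        coe_nnnorm, norm_inv] at h3
      exact h3
    have hn : 0 < ‖d i‖ := norm_pos_iff.2 (hd i)
    rw [h1, norm_mul, ← mul_assoc]
    refine le_mul_of_one_le_left (norm_nonneg _) ?_
    rwa [inv_le_iff_one_le_mul₀ hn] at h2
  · refine iSup_le fun i => ?_
    have h1 : B (b i) = (d i)⁻¹ • b i :=
      hinj (by rw [hAB, map_smul, hA, smul_smul, inv_mul_cancel₀ (hd i), one_smul])
    have hbi : ‖b i‖ₑ = 1 := by simp [enorm_eq_nnnorm]
    have h2 := B.le_opENorm (b i)
    rwa [h1, enorm_smul, hbi, mul_one, mul_one, enorm_inv (hd i)] at h2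

theorem Submodule.enorm_subtypeL_comp_comp_orthogonalProjectionOnto (K : Submodule ℝ T)
    [K.HasOrthogonalProjection] (B : K →L[ℝ] K) :
    ‖K.subtypeL ∘L B ∘L K.orthogonalProjectionOnto‖ₑ = ‖B‖ₑ := by
  rw [enorm_eq_iff_norm_eq]
  apply le_antisymm
  · refine ContinuousLinearMap.opNorm_le_bound _ (norm_nonneg _) fun v => ?_
    refine (B.le_opNorm _).trans ?_
    gcongr
    exact K.norm_orthogonalProjectionOnto_apply_le v
  · refine ContinuousLinearMap.opNorm_le_bound _ (norm_nonneg _) fun v => ?_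
    have := (K.subtypeL ∘L B ∘L K.orthogonalProjectionOnto).le_opNorm v
    simpa using this

end SpectralNorm

/-! ### Linearisation and conditioning of the critical point problem -/

section CriticalPoint

theorem mem_tangentSpaceOf_of_mem_criticalPointLocus {E : Type*} [NormedAddCommGroup E]
    [InnerProductSpace ℝ E] {M : Set E} {a x : E} {p : E × E}
    (hp : p ∈ tangentSpaceOf (criticalPointLocus M) (a, x)) : p.2 ∈ tangentSpaceOf M x := by
  induction hp using Submodule.span_induction with
  | mem p hp =>
    obtain ⟨γ, ε, hε, hγ, hγS, hγ0, hγd⟩ := hp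
    exact Submodule.subset_span ⟨fun t => (γ t).2, ε, hε, contDiff_snd.comp_contDiffOn hγ,
      fun t ht => (hγS t ht).1, by simp [hγ0], (ContinuousLinearMap.snd ℝ E E).hasFDerivAt.comp_hasDerivAt 0 hγd⟩
  | zero => exact Submodule.zero_mem _
  | add p q _ _ hp hq => exact Submodule.add_mem _ hp hq
  | smul c p _ hp => exact Submodule.smul_mem _ c hp

variable {E : Type*} [NormedAddCommGroup E] [InnerProductSpace ℝ E] [FiniteDimensional ℝ E]
  {M : Set E} {a x : E} {Φ : OpenPartialHomeomorph E E}

/-- For velocities of curves, this is the derivative of the normality condition tested against the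
moving tangent frame. It is linear in `p`, so it passes to their span. -/
theorem IsAdaptedChart.inner_fst_of_mem_tangentSpaceOf (h : IsAdaptedChart M x Φ) {p : E × E}
    (hp : p ∈ tangentSpaceOf (criticalPointLocus M) (a, x)) {z : E}
    (hz : z ∈ tangentSpaceOf M x) : inner ℝ p.1 z = inner ℝ p.2 z -
      inner ℝ (a - x) (fderiv ℝ (fderiv ℝ Φ.symm) 0 p.2 z) := by
  induction hp using Submodule.span_induction with
  | mem p hp =>
    obtain ⟨γ, ε, hε, -, hγS, hγ0, hγd⟩ := hp
    have h1 : HasDerivAt (fun t => (γ t).1) p.1 0 := (ContinuousLinearMap.fst ℝ E E).hasFDerivAt.comp_hasDerivAt 0 hγd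
    have h2 : HasDerivAt (fun t => (γ t).2) p.2 0 := (ContinuousLinearMap.snd ℝ E E).hasFDerivAt.comp_hasDerivAt 0 hγd
    have hx : (γ 0).2 = x := by rw [hγ0]
    have hA : HasDerivAt (fun t => fderiv ℝ Φ.symm (Φ (γ t).2) z)
        (fderiv ℝ (fderiv ℝ Φ.symm) 0 p.2 z) 0 := by
      have h3 : HasDerivAt (fun t => fderiv ℝ Φ.symm (Φ (γ t).2))
          (fderiv ℝ (fderiv ℝ Φ.symm) 0 p.2) 0 := by
        refine HasFDerivAt.comp_hasDerivAt (f := fun t => (γ t).2)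
          (l := fun y => fderiv ℝ Φ.symm (Φ y)) 0 ?_ h2
        rw [hx]
        exact h.hasFDerivAt_fderiv_symm
      simpa using h3.clm_apply (hasDerivAt_const (0 : ℝ) z)
    have hs : ∀ᶠ t in 𝓝 (0 : ℝ), (γ t).2 ∈ Φ.source :=
      h2.continuousAt.eventually_mem (Φ.open_source.mem_nhds (hx.symm ▸ h.mem_source))
    have heq := ((h1.sub h2).inner ℝ hA).unique
      ((hasDerivAt_const (0 : ℝ) (0 : ℝ)).congr_of_eventuallyEq (by
        filter_upwards [hs, Ioo_mem_nhds (neg_lt_zero.2 hε) hε] with t ht1 ht2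
        obtain ⟨h4, h5⟩ := hγS t ht2
        exact Submodule.inner_left_of_mem_orthogonal
          (h.fderiv_symm_mem_tangentSpaceOf ht1 h4 hz) h5))
    simp only [Pi.sub_apply, hγ0, h.map_base, h.fderiv_symm_zero,
      ContinuousLinearMap.id_apply, inner_sub_left p.1] at heq
    linarith
  | zero => simp
  | add p q _ _ hp hq => simp [inner_add_left, inner_add_right, hp, hq]; ring
  | smul c p _ hp => simp [inner_smul_left, inner_smul_right, hp]; ring

/-- The linearised equations of the critical point locus. -/
theorem IsAdaptedChart.distHessian_snd (h : IsAdaptedChart M x Φ)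
    (hax : (a, x) ∈ criticalPointLocus M) {p : E × E}
    (hp : p ∈ tangentSpaceOf (criticalPointLocus M) (a, x)) :
    distHessian M a x ⟨p.2, mem_tangentSpaceOf_of_mem_criticalPointLocus hp⟩ =
      (tangentSpaceOf M x).orthogonalProjectionOnto p.1 := by
  refine ext_inner_right ℝ fun z => ?_
  have h1 : inner ℝ ((tangentSpaceOf M x).orthogonalProjectionOnto p.1) z = inner ℝ p.1 (z : E) := by
    rw [real_inner_comm, Submodule.inner_orthogonalProjectionOnto_eq_of_mem_left, real_inner_comm]
  rw [h.inner_distHessian hax.2, h1, h.inner_fst_of_mem_tangentSpaceOf hp z.2]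
  rfl

theorem IsAdaptedChart.exists_isLocalSolutionMap (h : IsAdaptedChart M x Φ)
    (hax : (a, x) ∈ criticalPointLocus M) (hH : Function.Injective (distHessian M a x)) :
    ∃ f, IsLocalSolutionMap (criticalPointLocus M) (a, x) f := by
  set T := tangentSpaceOf M x with hT
  let P := T.starProjection
  let R : E × E → E := fun q => realAdjoint E E (fderiv ℝ Φ.symm (Φ q.2)) (q.1 - q.2)
  -- One smooth equation with values in E: the component in `Tᗮ` encodes membership of `q.2` in `M`,
  -- the component in `T` the normality of `q.1 - q.2`.
  let K : E × E → E := fun q => P (R q) + (Φ q.2 - P (Φ q.2))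
  let W : Set (E × E) := Prod.snd ⁻¹' Φ.source
  have hW : IsOpen W := Φ.open_source.preimage continuous_snd
  have hΦ : ContDiffOn ℝ ∞ (fun q : E × E => Φ q.2) W :=
    h.contDiffOn.comp contDiff_snd.contDiffOn fun q hq => hq
  have hR : ContDiffOn ℝ ∞ R W := by
    have h1 : ContDiffOn ℝ ∞ (fun q : E × E => fderiv ℝ Φ.symm (Φ q.2)) W :=
      h.contDiffOn_fderiv_symm.comp hΦ fun q hq => Φ.map_source hq
    exact ((realAdjoint E E).contDiff.comp_contDiffOn h1).clm_apply
      (contDiff_fst.sub contDiff_snd).contDiffOn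
  have hK : ContDiffOn ℝ ∞ K W :=
    (P.contDiff.comp_contDiffOn hR).add (hΦ.sub (P.contDiff.comp_contDiffOn hΦ))
  have hKT : ∀ q, ∀ z ∈ T, inner ℝ (K q) z =
      inner ℝ (q.1 - q.2) (fderiv ℝ Φ.symm (Φ q.2) z) := by
    intro q z hz
    have hPz : P z = z := Submodule.starProjection_eq_self_iff.2 hz
    simp only [K, inner_add_left, inner_sub_left, P, R,
      Submodule.inner_starProjection_left_eq_right]
    rw [show T.starProjection z = z from hPz, inner_realAdjoint_left, sub_self, add_zero,
      inner_sub_left]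
  have hKN : ∀ q, ∀ u ∈ Tᗮ, inner ℝ (K q) u = inner ℝ (Φ q.2) u := by
    intro q u hu
    have hPu : T.starProjection u = 0 := (Submodule.starProjection_apply_eq_zero_iff T).2 hu
    simp only [K, inner_add_left, inner_sub_left, P, Submodule.inner_starProjection_left_eq_right,
      hPu, inner_zero_right, zero_add, sub_zero]
  have hS : ∀ q ∈ W, q ∈ criticalPointLocus M ↔ K q = 0 := by
    intro q hq
    have hq' : q.2 ∈ Φ.source := hq
    have h1 : q.2 ∈ M ↔ ∀ u ∈ Tᗮ, inner ℝ (K q) u = 0 := by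
      rw [h.mem_iff _ hq', ← hT, ← Submodule.orthogonal_orthogonal T, Submodule.mem_orthogonal',
        Submodule.orthogonal_orthogonal]
      exact forall₂_congr fun u hu => by rw [hKN q u hu]
    have h2 : q.2 ∈ M → (q.1 - q.2 ∈ normalSpaceOf M q.2 ↔ ∀ z ∈ T, inner ℝ (K q) z = 0) := by
      intro hqM
      rw [normalSpaceOf, h.tangentSpaceOf_eq hq' hqM, Submodule.mem_orthogonal']
      constructor
      · intro h3 z hz
        rw [hKT q z hz]
        exact h3 _ ⟨z, hz, rfl⟩
      · rintro h3 _ ⟨z, hz, rfl⟩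
        exact (hKT q z hz).symm.trans (h3 z hz)
    constructor
    · rintro ⟨hqM, hqN⟩
      refine ext_inner_right ℝ fun u => ?_
      have h3 := h1.1 hqM _ (Submodule.sub_starProjection_mem_orthogonal (K := T) u)
      have h4 := (h2 hqM).1 hqN _ (Submodule.starProjection_apply_mem T u)
      rw [inner_sub_right, h4, sub_zero] at h3
      rw [h3, inner_zero_left]
    · intro h0
      have hqM : q.2 ∈ M := h1.2 fun u _ => by rw [h0, inner_zero_left]
      exact ⟨hqM, (h2 hqM).2 fun z _ => by rw [h0, inner_zero_left]⟩
  refine _root_.exists_isLocalSolutionMap hW (p := (a, x)) h.mem_source hax hK hS fun v hv => ?_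
  have hl : HasDerivAt (fun s : ℝ => x + s • v) v 0 := by
    simpa using ((hasDerivAt_id (0 : ℝ)).smul_const v).const_add x
  have hKl : HasDerivAt (fun s : ℝ => K (a, x + s • v)) 0 0 := by
    have h1 : HasFDerivAt K (fderiv ℝ K (a, x)) (a, x + (0 : ℝ) • v) := by
      simpa using ((hK.contDiffAt (hW.mem_nhds h.mem_source)).differentiableAt
        (by simp)).hasFDerivAt
    exact hv ▸ h1.comp_hasDerivAt (f := fun s : ℝ => (a, x + s • v)) 0
      ((hasDerivAt_const (0 : ℝ) a).prodMk hl)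
  -- The normal component of `K` is that of `Φ`, whose derivative at `x` is the identity; so a
  -- kernel vector `v` is tangent. The tangential component then says that the Hessian kills `v`.
  have hvT : v ∈ T := by
    rw [← Submodule.orthogonal_orthogonal T, Submodule.mem_orthogonal']
    intro u hu
    have h1 : HasDerivAt (fun s : ℝ => Φ (x + s • v)) v 0 := by
      refine HasFDerivAt.comp_hasDerivAt (f := fun s : ℝ => x + s • v)
        (l' := ContinuousLinearMap.id ℝ E) 0 ?_ hl
      simpa using h.hasFDerivAt_base
    have h2 := hKl.inner ℝ (hasDerivAt_const (0 : ℝ) u)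
    simp only [hKN _ u hu] at h2
    simpa using (h1.inner ℝ (hasDerivAt_const (0 : ℝ) u)).unique h2
  suffices hHv : distHessian M a x ⟨v, hvT⟩ = 0 from
    congrArg Subtype.val (hH (hHv.trans (map_zero _).symm))
  refine ext_inner_right ℝ fun z => ?_
  have hA : HasDerivAt (fun s : ℝ => fderiv ℝ Φ.symm (Φ (x + s • v)) (z : E))
      (fderiv ℝ (fderiv ℝ Φ.symm) 0 v z) 0 := by
    have h1 : HasDerivAt (fun s : ℝ => fderiv ℝ Φ.symm (Φ (x + s • v)))
        (fderiv ℝ (fderiv ℝ Φ.symm) 0 v) 0 := by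
      refine HasFDerivAt.comp_hasDerivAt (f := fun s : ℝ => x + s • v)
        (l := fun y => fderiv ℝ Φ.symm (Φ y)) 0 ?_ hl
      simpa using h.hasFDerivAt_fderiv_symm
    simpa using h1.clm_apply (hasDerivAt_const (0 : ℝ) (z : E))
  have h2 := hKl.inner ℝ (hasDerivAt_const (0 : ℝ) (z : E))
  simp only [hKT _ z z.2] at h2
  have h3 := ((hl.const_sub a).inner ℝ hA).unique h2
  simp only [zero_smul, add_zero, h.map_base, h.fderiv_symm_zero, ContinuousLinearMap.id_apply,
    inner_neg_left, inner_zero_left, inner_zero_right] at h3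
  rw [h.inner_distHessian hax.2, inner_zero_left]
  change inner ℝ v (z : E) - _ = 0
  linarith

/-- Both directions rest on H ẋ = P ȧ. Lifting tangent inputs shows H surjective, hence bijective by
dimension. Conversely, ȧ = 0 forces ẋ = 0 when H is injective, and the graph of a local solution map
supplies every ȧ. -/
theorem IsAdaptedChart.bijective_inputProjDeriv_iff (h : IsAdaptedChart M x Φ)
    (hax : (a, x) ∈ criticalPointLocus M) :
    Function.Bijective (inputProjDeriv (criticalPointLocus M) (a, x)) ↔
      IsUnit (distHessian M a x) := by
  have := FiniteDimensional.complete ℝ (tangentSpaceOf M x)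
  rw [ContinuousLinearMap.isUnit_iff_bijective]
  constructor
  · rintro ⟨-, hsurj⟩
    have hs : Function.Surjective (distHessian M a x) := by
      intro z
      obtain ⟨p, hp⟩ := hsurj z
      refine ⟨_, (h.distHessian_snd hax p.2).trans ?_⟩
      change (p : E × E).1 = z at hp
      rw [hp, Submodule.orthogonalProjectionOnto_mem_subspace_eq_self]
    exact ⟨LinearMap.injective_iff_surjective
      (f := (distHessian M a x : tangentSpaceOf M x →ₗ[ℝ] tangentSpaceOf M x)).2 hs, hs⟩
  · rintro ⟨hinj, -⟩
    obtain ⟨f, hf⟩ := h.exists_isLocalSolutionMap hax hinj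
    refine ⟨(injective_iff_map_eq_zero _).2 ?_, fun u =>
      ⟨⟨_, hf.mk_fderiv_mem_tangentSpaceOf hax u⟩, rfl⟩⟩
    rintro ⟨p, hp⟩ hp0
    change p.1 = 0 at hp0
    have h1 := h.distHessian_snd hax hp
    rw [hp0, map_zero] at h1
    exact Subtype.ext (Prod.ext hp0 (congrArg Subtype.val (hinj (h1.trans (map_zero _).symm))))

theorem IsLocalSolutionMap.fderiv_criticalPointLocus (h : IsAdaptedChart M x Φ)
    (hax : (a, x) ∈ criticalPointLocus M) (hH : IsUnit (distHessian M a x)) {f : E → E}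
    (hf : IsLocalSolutionMap (criticalPointLocus M) (a, x) f) :
    fderiv ℝ f a = (tangentSpaceOf M x).subtypeL ∘L Ring.inverse (distHessian M a x) ∘L
      (tangentSpaceOf M x).orthogonalProjectionOnto := by
  ext1 u
  have h1 := h.distHessian_snd hax (hf.mk_fderiv_mem_tangentSpaceOf hax u)
  have h2 := congrArg ⇑(Ring.inverse (distHessian M a x)) h1
  have h3 : ∀ v, Ring.inverse (distHessian M a x) (distHessian M a x v) = v := fun v =>
    DFunLike.congr_fun (Ring.inverse_mul_cancel _ hH) v
  rw [h3] at h2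
  exact congrArg Subtype.val h2

theorem IsAdaptedChart.conditionNumber_eq (h : IsAdaptedChart M x Φ)
    (hax : (a, x) ∈ criticalPointLocus M) :
    conditionNumber (criticalPointLocus M) M (a, x) =
      spectralNormOfInverse (distHessian M a x) := by
  have := FiniteDimensional.complete ℝ (tangentSpaceOf M x)
  rw [conditionNumber, spectralNormOfInverse]
  by_cases hH : IsUnit (distHessian M a x)
  · rw [if_pos ((h.bijective_inputProjDeriv_iff hax).2 hH), if_pos hH]
    obtain ⟨f, hf⟩ := h.exists_isLocalSolutionMap hax
      (ContinuousLinearMap.isUnit_iff_bijective.1 hH).1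
    have hκ : riceConditionNumber M f a = ‖Ring.inverse (distHessian M a x)‖ₑ := by
      rw [hf.riceConditionNumber_eq_enorm_fderiv (fun q hq => hq.1),
        hf.fderiv_criticalPointLocus h hax hH,
        Submodule.enorm_subtypeL_comp_comp_orthogonalProjectionOnto]
    rw [← hκ]
    -- All local solution maps have the same condition number, so the infimum equals the value at
    -- `f`.
    exact le_antisymm (iInf₂_le f hf)
      (le_iInf₂ fun g hg => (hf.riceConditionNumber_eq M hax hg).le)
  · rw [if_neg (mt (h.bijective_inputProjDeriv_iff hax).1 hH), if_neg hH]

theorem IsAdaptedChart.distHessian_eq (h : IsAdaptedChart M x Φ)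
    (hax : (a, x) ∈ criticalPointLocus M) :
    distHessian M a x = 1 - weingartenMap M x (a - x) := by
  ext1 v
  refine ext_inner_right ℝ fun z => ?_
  rw [h.inner_distHessian hax.2, sub_apply, inner_sub_left (_ : tangentSpaceOf M x),
    h.inner_weingartenMap (η := a - x) hax.2]
  rfl

/-- Self-adjointness comes from the symmetry of the second derivative of `Φ.symm`. -/
theorem IsAdaptedChart.isSymmetric_weingartenMap (h : IsAdaptedChart M x Φ) {η : E}
    (hη : η ∈ normalSpaceOf M x) :
    (weingartenMap M x η : tangentSpaceOf M x →ₗ[ℝ] tangentSpaceOf M x).IsSymmetric := by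
  intro v z
  change inner ℝ (weingartenMap M x η v) z = inner ℝ v (weingartenMap M x η z)
  rw [real_inner_comm, real_inner_comm, real_inner_comm _ v, h.inner_weingartenMap hη,
    h.inner_weingartenMap hη, h.fderiv_fderiv_symm_comm]

theorem IsAdaptedChart.weingartenMap_smul (h : IsAdaptedChart M x Φ) {η : E}
    (hη : η ∈ normalSpaceOf M x) (c : ℝ) :
    weingartenMap M x (c • η) = c • weingartenMap M x η := by
  ext1 v
  refine ext_inner_right ℝ fun z => ?_
  rw [h.inner_weingartenMap (Submodule.smul_mem _ c hη), smul_apply,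
    inner_smul_left, inner_smul_left, h.inner_weingartenMap hη]

end CriticalPoint

theorem mainTheorem2 {m n : ℕ} (M : Set (EuclideanSpace ℝ (Fin n)))
    (hM : IsEmbeddedSubmanifold m M) (a x : EuclideanSpace ℝ (Fin n))
    (hax : (a, x) ∈ criticalPointLocus M) :
    distHessian M a x = 1 - weingartenMap M x (a - x) ∧
    conditionNumber (criticalPointLocus M) M (a, x) =
      spectralNormOfInverse (distHessian M a x) ∧
    (∀ w ∈ normalSpaceOf M x, ‖w‖ = 1 → a - x = ‖a - x‖ • w →
      ∃ (u : OrthonormalBasis (Fin m) ℝ (tangentSpaceOf M x)) (c : Fin m → ℝ),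
        (∀ i, weingartenMap M x w (u i) = c i • u i) ∧
        conditionNumber (criticalPointLocus M) M (a, x) =
          ⨆ i, (ENNReal.ofReal |1 - c i * ‖a - x‖|)⁻¹) ∧
    ((a, x) ∉ wellPosedLocus M → ¬ IsUnit (distHessian M a x)) := by

  obtain ⟨hm, Φ, h⟩ := hM.exists_isAdaptedChart hax.1
  refine ⟨h.distHessian_eq hax, h.conditionNumber_eq hax, fun w hw _ haw => ?_, fun hwp hU =>
    hwp ⟨hax, (h.bijective_inputProjDeriv_iff hax).2 hU⟩⟩
  have hsymm := h.isSymmetric_weingartenMap hw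
  have hS : ∀ i, weingartenMap M x w (hsymm.eigenvectorBasis hm i) =
      hsymm.eigenvalues hm i • hsymm.eigenvectorBasis hm i :=
    hsymm.apply_eigenvectorBasis hm
  refine ⟨hsymm.eigenvectorBasis hm, hsymm.eigenvalues hm, hS, ?_⟩
  rw [h.conditionNumber_eq hax]
  refine spectralNormOfInverse_eq_iSup (hsymm.eigenvectorBasis hm) fun i => ?_
  -- Rewriting with `haw` also changes the norm on the right-hand side; the final reverse rewrite
  -- restores it.
  rw [h.distHessian_eq hax, haw, h.weingartenMap_smul hw, ← haw]
  simp only [sub_apply, smul_apply, hS, one_apply_eq_self]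
  rw [sub_smul, one_smul, smul_smul, mul_comm]
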